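/- Let $\mathcal E,\mathcal E_1,\mathcal K$ be finite-dimensional real Hilbert spaces, let $T:\mathcal E\to\mathcal K$ and $A:\mathcal E\to\mathcal E_1$ be linear, and let $g\in\mathcal K$ and $f\in\mathcal E_1$, where $f$ lies in the range of $A$ (for instance, $A$ is surjective). Let $v_1,\dots,v_m$ denote the components of $v\in\mathcal E$ with respect to a fixed basis of $\mathcal E$, $m=\dim\mathcal E$. Let $p\ge 1$, $r>0$ and $\gamma>0$ be real. For $0\le\varepsilon<r$ let $W_r^{p,\varepsilon}:\mathbb R\to\mathbb R$ be the even function given for $t\ge 0$ by $$W_r^{p,\varepsilon}(t)=\begin{cases}t^p,& t\le r-\varepsilon,\\ \pi_p(t),& r-\varepsilon< t< r+\varepsilon,\\ r^p,& t\ge r+\varepsilon,\end{cases}$$ where, for $\varepsilon>0$, $\pi_p$ is the cubic polynomial $\pi_p(t)=a(t-r-\varepsilon)^3+b(t-r-\varepsilon)^2+r^p$ with $$b=\frac{p(r-\varepsilon)^{p-1}}{2\varepsilon}-\frac{3\,(r^p-(r-\varepsilon)^p)}{4\varepsilon^2},\qquad a=\frac{p(r-\varepsilon)^{p-1}}{12\,\varepsilon^2}+\frac{b}{3\varepsilon}$$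 (equivalently, the cubic that makes $W_r^{p,\varepsilon}$ continuously differentiable at $t=r\pm\varepsilon$); for $\varepsilon=0$ the middle case is empty, so $W_r^{p,0}(t)=\min\{|t|^p,r^p\}$. Put $$\mathcal J_p^\varepsilon(v)=\|Tv-g\|^2+\gamma\sum_{i=1}^m W_r^{p,\varepsilon}(v_i).$$ Then for every $0\le\varepsilon<r$ the problem of minimizing $\mathcal J_p^\varepsilon(v)$ subject to $Av=f$ has a solution in $\mathcal E$. Moreover, there is a compact set $M\subset\mathcal E$, independent of $\varepsilon$, such that for every $0\le\varepsilon<r$ this problem has a solution belonging to $M$. -/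

import Mathlib

noncomputable section

/-- The quadratic coefficient `B` of the interpolating cubic. -/
def cubicB (s₁ s₂ γ₁ γ₂ γ₃ : ℝ) : ℝ :=
  γ₁ / (s₂ - s₁) - 3 * (γ₃ - γ₂) / (s₂ - s₁) ^ 2

/-- The cubic coefficient `A` of the interpolating cubic. -/
def cubicA (s₁ s₂ γ₁ γ₂ γ₃ : ℝ) : ℝ :=
  γ₁ / (3 * (s₂ - s₁) ^ 2) + 2 * cubicB s₁ s₂ γ₁ γ₂ γ₃ / (3 * (s₂ - s₁))

/-- The cubic polynomial `π(t) = A (t - s₂)³ + B (t - s₂)² + C` which, for `s₁ < s₂`, satisfies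
`π(s₁) = γ₂`, `π'(s₁) = γ₁`, `π(s₂) = γ₃`, `π'(s₂) = 0`. -/
def interpCubic (s₁ s₂ γ₁ γ₂ γ₃ t : ℝ) : ℝ :=
  cubicA s₁ s₂ γ₁ γ₂ γ₃ * (t - s₂) ^ 3 + cubicB s₁ s₂ γ₁ γ₂ γ₃ * (t - s₂) ^ 2 + γ₃

/-- The regularized truncated power `W_r^{p,ε}`, an even function of `t`. For `ε = 0` the middle
case is empty and this is the truncated power `min {|t|^p, r^p}`. -/
def truncPow (p r ε t : ℝ) : ℝ :=
  if |t| ≤ r - ε then |t| ^ p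
  else if |t| < r + ε then
    interpCubic (r - ε) (r + ε) (p * (r - ε) ^ (p - 1)) ((r - ε) ^ p) (r ^ p) |t|
  else r ^ p

/-- The functional `J_p^ε(v) = ‖T v - g‖² + γ ∑ᵢ W_r^{p,ε}(vᵢ)`, where `vᵢ` are the components of
`v` with respect to the basis `b`. -/
def objective {E K : Type*} [NormedAddCommGroup E] [InnerProductSpace ℝ E]
    [NormedAddCommGroup K] [InnerProductSpace ℝ K] {m : ℕ} (b : Module.Basis (Fin m) ℝ E)
    (T : E →ₗ[ℝ] K) (g : K) (γ p r ε : ℝ) (v : E) : ℝ :=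
  ‖T v - g‖ ^ 2 + γ * ∑ i, truncPow p r ε (b.repr v i)

/-- The solutions of the problem: minimize `J v` subject to `A v = f`. -/
def constrainedMinimizers {E E₁ : Type*} [AddCommGroup E] [Module ℝ E]
    [AddCommGroup E₁] [Module ℝ E₁] (J : E → ℝ) (A : E →ₗ[ℝ] E₁) (f : E₁) : Set E :=
  {v | A v = f ∧ ∀ w, A w = f → J v ≤ J w}

end

/-! The objective need not be coercive, so the feasible set is cut down to a fixed ball. The penalty
lies in `[0, r ^ p]` and equals `r ^ p` once `|t| ≥ 2 * r` (`truncPow_mem_Icc`,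
`truncPow_of_le_abs`). A feasible `v` no worse than `v₀` therefore has `T v` bounded independently
of `ε`. Keeping `A v`, `T v` and the small coordinates of `v`, `exists_bounded_competitor` yields a
bounded `w`; the coordinates that change already paid the maximal penalty, so the objective does not
grow. Continuity and compactness finish. -/

theorem interpCubic_eq_hermite {s₁ s₂ : ℝ} (h : s₁ ≠ s₂) (γ₁ γ₂ γ₃ s : ℝ) :
    interpCubic s₁ s₂ γ₁ γ₂ γ₃ (s₂ - (s₂ - s₁) * s) =
      γ₂ + (γ₃ - γ₂) * (1 - 3 * s ^ 2 + 2 * s ^ 3) + γ₁ * (s₂ - s₁) * (s ^ 2 - s ^ 3) := by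
  have h' : s₂ - s₁ ≠ 0 := sub_ne_zero.2 h.symm
  unfold interpCubic cubicA cubicB
  field_simp
  ring

theorem interpCubic_left {s₁ s₂ : ℝ} (h : s₁ ≠ s₂) (γ₁ γ₂ γ₃ : ℝ) :
    interpCubic s₁ s₂ γ₁ γ₂ γ₃ s₁ = γ₂ := by
  have := interpCubic_eq_hermite h γ₁ γ₂ γ₃ 1
  norm_num at this
  exact this

theorem interpCubic_right (s₁ s₂ γ₁ γ₂ γ₃ : ℝ) :
    interpCubic s₁ s₂ γ₁ γ₂ γ₃ s₂ = γ₃ := by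
  simp [interpCubic]

theorem continuous_interpCubic (s₁ s₂ γ₁ γ₂ γ₃ : ℝ) :
    Continuous (interpCubic s₁ s₂ γ₁ γ₂ γ₃) := by
  unfold interpCubic
  fun_prop

/-- If the initial slope is nonnegative and at most twice the mean slope, the interpolating cubic
stays between its end values. -/
theorem interpCubic_mem_Icc {s₁ s₂ γ₁ γ₂ γ₃ t : ℝ} (h₁ : s₁ < t) (h₂ : t < s₂) (hγ₁ : 0 ≤ γ₁)
    (hγ : γ₁ * (s₂ - s₁) ≤ 2 * (γ₃ - γ₂)) :
    interpCubic s₁ s₂ γ₁ γ₂ γ₃ t ∈ Set.Icc γ₂ γ₃ := by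
  have hpos : 0 < s₂ - s₁ := by linarith
  obtain ⟨s, rfl⟩ : ∃ s, t = s₂ - (s₂ - s₁) * s :=
    ⟨(s₂ - t) / (s₂ - s₁), by field_simp; ring⟩
  have hs₀ : 0 ≤ s := by
    by_contra! hs
    nlinarith
  have hs₁ : s ≤ 1 := by
    by_contra! hs
    nlinarith
  rw [interpCubic_eq_hermite (by linarith : s₁ < s₂).ne]
  have hd : 0 ≤ γ₁ * (s₂ - s₁) := mul_nonneg hγ₁ hpos.le
  have hq : 0 ≤ s ^ 2 - s ^ 3 := by
    have : 0 ≤ s ^ 2 * (1 - s) := mul_nonneg (sq_nonneg s) (by linarith)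
    linarith
  have hu : 0 ≤ 1 - 3 * s ^ 2 + 2 * s ^ 3 := by
    have : 0 ≤ (1 - s) ^ 2 * (1 + 2 * s) := mul_nonneg (sq_nonneg _) (by linarith)
    linarith
  constructor
  · linarith [mul_nonneg (by linarith : 0 ≤ γ₃ - γ₂) hu, mul_nonneg hd hq]
  -- Replacing `γ₁ * (s₂ - s₁)` by `2 * (γ₃ - γ₂)` turns the Hermite form into `γ₂ + (γ₃ - γ₂) * (1
  -- - s ^ 2)`.
  · have h₃ := mul_le_mul_of_nonneg_right hγ hq
    have h₄ := mul_nonneg (by linarith : 0 ≤ γ₃ - γ₂) (sq_nonneg s)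
    linarith

/-- The tangent line inequality for the convex function `t ↦ t ^ p`. -/
theorem rpow_add_mul_sub_le_rpow {p s r : ℝ} (hp : 1 ≤ p) (hs : 0 < s) (hsr : s ≤ r) :
    s ^ p + p * s ^ (p - 1) * (r - s) ≤ r ^ p := by
  have h := one_add_mul_self_le_rpow_one_add
    (show -1 ≤ (r - s) / s by
      have : 0 ≤ (r - s) / s := div_nonneg (by linarith) hs.le
      linarith) hp
  have hr : r = s * (1 + (r - s) / s) := by field_simp; ring
  have hfac : 0 ≤ 1 + (r - s) / s := by
    have : 0 ≤ (r - s) / s := div_nonneg (by linarith) hs.le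
    linarith
  calc s ^ p + p * s ^ (p - 1) * (r - s) = s ^ p * (1 + p * ((r - s) / s)) := by
        rw [Real.rpow_sub_one hs.ne']
        ring
    _ ≤ s ^ p * (1 + (r - s) / s) ^ p := by gcongr
    _ = r ^ p := by rw [← Real.mul_rpow hs.le hfac, ← hr]

theorem truncPow_mem_Icc {p r ε : ℝ} (hp : 1 ≤ p) (hε : 0 ≤ ε) (hεr : ε < r) (t : ℝ) :
    truncPow p r ε t ∈ Set.Icc 0 (r ^ p) := by
  have hs : 0 < r - ε := by linarith
  unfold truncPow
  split_ifs with h₁ h₂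
  · exact ⟨by positivity,
      Real.rpow_le_rpow (abs_nonneg t) (by linarith) (by linarith)⟩
  -- The nodes are `2 * ε` apart, so the slope condition is twice the tangent inequality between `r
  -- - ε` and `r`.
  · have h := interpCubic_mem_Icc (γ₁ := p * (r - ε) ^ (p - 1)) (γ₂ := (r - ε) ^ p)
      (γ₃ := r ^ p) (not_le.1 h₁) h₂ (by positivity)
      (by linarith [rpow_add_mul_sub_le_rpow hp hs (by linarith : r - ε ≤ r)])
    exact ⟨le_trans (by positivity) h.1, h.2⟩
  · exact ⟨Real.rpow_nonneg (by linarith) p, le_rfl⟩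

theorem truncPow_of_le_abs {p r ε t : ℝ} (hε : 0 ≤ ε) (ht : r + ε ≤ |t|) :
    truncPow p r ε t = r ^ p := by
  unfold truncPow
  split_ifs with h₁ h₂
  -- Both bounds on `|t|` force `ε = 0`.
  · rw [show |t| = r by linarith]
  · linarith
  · rfl

theorem continuous_truncPow {p r ε : ℝ} (hp : 1 ≤ p) (hε : 0 ≤ ε) :
    Continuous (truncPow p r ε) := by
  have hinner : Continuous fun t : ℝ => if |t| < r + ε then
      interpCubic (r - ε) (r + ε) (p * (r - ε) ^ (p - 1)) ((r - ε) ^ p) (r ^ p) |t|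
      else r ^ p := by
    simp_rw [← not_le, ite_not]
    refine Continuous.if_le continuous_const
      ((continuous_interpCubic _ _ _ _ _).comp continuous_abs) continuous_const
      continuous_abs fun t ht => ?_
    rw [← ht, interpCubic_right]
  unfold truncPow
  refine Continuous.if_le (continuous_abs.rpow_const fun _ => Or.inr (by linarith)) hinner
    continuous_abs continuous_const fun t ht => ?_
  rcases hε.eq_or_lt with rfl | hε
  -- The nodes coincide here, but `|t| = r` selects the constant branch, so the degenerate cubic is
  -- never evaluated.
  · simp [ht]
  · rw [if_pos (by linarith), ht, interpCubic_left (by linarith : r - ε < r + ε).ne]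

theorem continuous_objective {E K : Type*} [NormedAddCommGroup E] [InnerProductSpace ℝ E]
    [FiniteDimensional ℝ E] [NormedAddCommGroup K] [InnerProductSpace ℝ K] {m : ℕ}
    (b : Module.Basis (Fin m) ℝ E) (T : E →ₗ[ℝ] K) (g : K) (γ : ℝ) {p r ε : ℝ}
    (hp : 1 ≤ p) (hε : 0 ≤ ε) : Continuous (objective b T g γ p r ε) := by
  have hT : Continuous T := T.continuous_of_finiteDimensional
  have hb (i : Fin m) : Continuous fun v => b.repr v i :=
    (b.coord i).continuous_of_finiteDimensional
  have hW := continuous_truncPow (r := r) hp hε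
  unfold objective
  fun_prop

/-- A linear map on a finite-dimensional space admits preimages bounded by their images. -/
theorem LinearMap.exists_preimage_norm_le_of_finiteDimensional {E F : Type*}
    [NormedAddCommGroup E] [NormedSpace ℝ E] [FiniteDimensional ℝ E]
    [NormedAddCommGroup F] [NormedSpace ℝ F] (L : E →ₗ[ℝ] F) :
    ∃ C, 0 ≤ C ∧ ∀ v, ∃ w, L w = L v ∧ ‖w‖ ≤ C * ‖L v‖ := by
  obtain ⟨S, hS⟩ := L.rangeRestrict.exists_rightInverse_of_surjective L.range_rangeRestrict
  refine ⟨‖S.toContinuousLinearMap‖, ContinuousLinearMap.opNorm_nonneg _, fun v => ⟨S (L.rangeRestrict v), ?_, ?_⟩⟩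
  · exact congrArg Subtype.val (LinearMap.congr_fun hS (L.rangeRestrict v))
  · exact S.toContinuousLinearMap.le_opNorm (L.rangeRestrict v)

/-- Competitors may be moved into a fixed ball while keeping their images under `A` and `T` and
their small coordinates. -/
theorem exists_bounded_competitor {E E₁ K : Type*}
    [NormedAddCommGroup E] [NormedSpace ℝ E] [FiniteDimensional ℝ E]
    [NormedAddCommGroup E₁] [NormedSpace ℝ E₁] [NormedAddCommGroup K] [NormedSpace ℝ K]
    {m : ℕ} (b : Module.Basis (Fin m) ℝ E) (T : E →ₗ[ℝ] K) (A : E →ₗ[ℝ] E₁) (f : E₁)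
    (ρ D : ℝ) :
    ∃ R, ∀ v, A v = f → ‖T v‖ ≤ D → ∃ w, A w = f ∧ T w = T v ∧
      (∀ i, |b.repr v i| ≤ ρ → b.repr w i = b.repr v i) ∧ ‖w‖ ≤ R := by
  classical
  let L (I : Finset (Fin m)) : E →ₗ[ℝ] E₁ × K × (I → ℝ) :=
    A.prod (T.prod (LinearMap.pi fun i => b.coord i))
  choose C hC hL using fun I => (L I).exists_preimage_norm_le_of_finiteDimensional
  -- The set of small coordinates depends on `v`, but has finitely many possible values; the sum
  -- dominates every case.
  refine ⟨∑ I, C I * max ‖f‖ (max D (max ρ 0)), fun v hA hT => ?_⟩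
  set I : Finset (Fin m) := {i | |b.repr v i| ≤ ρ} with hI
  obtain ⟨w, hw, hnorm⟩ := hL I v
  simp only [L, LinearMap.prod_apply, Function.prod_apply, Prod.mk.injEq] at hw
  refine ⟨w, hw.1.trans hA, hw.2.1, fun i hi => ?_, hnorm.trans ?_⟩
  · exact congrFun hw.2.2 ⟨i, by simpa [hI] using hi⟩
  · have hv : ‖L I v‖ ≤ max ‖f‖ (max D (max ρ 0)) := by
      refine max_le_max (le_of_eq (congrArg norm hA)) (max_le_max hT ?_)
      refine (pi_norm_le_iff_of_nonneg (le_max_right _ _)).2 fun i => le_max_of_le_left ?_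
      exact (Finset.mem_filter.1 i.2).2
    have hmax : 0 ≤ max ‖f‖ (max D (max ρ 0)) := le_max_of_le_left (norm_nonneg f)
    calc C I * ‖L I v‖ ≤ C I * max ‖f‖ (max D (max ρ 0)) :=
          mul_le_mul_of_nonneg_left hv (hC I)
      _ ≤ _ := Finset.single_le_sum
          (f := fun I => C I * max ‖f‖ (max D (max ρ 0)))
          (fun J _ => mul_nonneg (hC J) hmax) (Finset.mem_univ I)

theorem exists_compact_forall_constrainedMinimizers {E E₁ K : Type*}
    [NormedAddCommGroup E] [InnerProductSpace ℝ E] [FiniteDimensional ℝ E]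
    [NormedAddCommGroup E₁] [InnerProductSpace ℝ E₁]
    [NormedAddCommGroup K] [InnerProductSpace ℝ K]
    {m : ℕ} (b : Module.Basis (Fin m) ℝ E)
    (T : E →ₗ[ℝ] K) (g : K) (A : E →ₗ[ℝ] E₁) (f : E₁) (hf : ∃ v, A v = f)
    (γ p r : ℝ) (hγ : 0 < γ) (hp : 1 ≤ p) :
    ∃ M : Set E, IsCompact M ∧ ∀ ε : ℝ, 0 ≤ ε → ε < r →
      (constrainedMinimizers (objective b T g γ p r ε) A f ∩ M).Nonempty := by
  obtain ⟨v₀, hv₀⟩ := hf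
  -- The threshold `2 * r` exceeds `r + ε` for every admissible `ε`, which makes `R` uniform.
  obtain ⟨R, hR⟩ := exists_bounded_competitor b T A f (2 * r)
    (√(‖T v₀ - g‖ ^ 2 + γ * (m * r ^ p)) + ‖g‖)
  set M := Metric.closedBall (0 : E) (max R ‖v₀‖)
  refine ⟨M, isCompact_closedBall _ _, fun ε hε hεr => ?_⟩
  have hW := truncPow_mem_Icc hp hε hεr
  have hbound : objective b T g γ p r ε v₀ ≤ ‖T v₀ - g‖ ^ 2 + γ * (m * r ^ p) := by
    unfold objective
    gcongr
    simpa using Finset.sum_le_sum fun i (_ : i ∈ Finset.univ) => (hW (b.repr v₀ i)).2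
  have hv₀M : v₀ ∈ M := by simp [M]
  have hred : ∀ v, A v = f → ∃ w ∈ M, A w = f ∧
      objective b T g γ p r ε w ≤ objective b T g γ p r ε v := by
    intro v hv
    rcases le_total (objective b T g γ p r ε v₀) (objective b T g γ p r ε v) with h | h
    · exact ⟨v₀, hv₀M, hv₀, h⟩
    have hsq : ‖T v - g‖ ^ 2 ≤ ‖T v₀ - g‖ ^ 2 + γ * (m * r ^ p) := by
      have : 0 ≤ γ * ∑ i, truncPow p r ε (b.repr v i) :=
        mul_nonneg hγ.le (Finset.sum_nonneg fun i _ => (hW _).1)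
      unfold objective at h hbound
      linarith
    have hTv : ‖T v‖ ≤ √(‖T v₀ - g‖ ^ 2 + γ * (m * r ^ p)) + ‖g‖ := by
      have h₁ := Real.le_sqrt_of_sq_le hsq
      have h₂ := norm_le_norm_sub_add (T v) g
      linarith
    obtain ⟨w, hAw, hTw, hw, hwR⟩ := hR v hv hTv
    refine ⟨w, by simp [M, hwR], hAw, ?_⟩
    unfold objective
    rw [hTw]
    gcongr with i
    rcases le_or_gt |b.repr v i| (2 * r) with hi | hi
    · rw [hw i hi]
    · rw [truncPow_of_le_abs hε (by linarith : r + ε ≤ |b.repr v i|)]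
      exact (hW _).2
  have hA : IsClosed {v | A v = f} :=
    isClosed_eq A.continuous_of_finiteDimensional continuous_const
  obtain ⟨v, ⟨hvM, hvA⟩, hmin⟩ := ((isCompact_closedBall _ _ : IsCompact M).inter_right hA)
    |>.exists_isMinOn ⟨v₀, hv₀M, hv₀⟩ (continuous_objective b T g γ hp hε).continuousOn
  refine ⟨v, ⟨hvA, fun w hw => ?_⟩, hvM⟩
  obtain ⟨w', hw'M, hw'A, hle⟩ := hred w hw
  exact (hmin ⟨hw'M, hw'A⟩).trans hle

theorem theorem3p3
    {E E₁ K : Type*}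
    [NormedAddCommGroup E] [InnerProductSpace ℝ E] [FiniteDimensional ℝ E]
    [NormedAddCommGroup E₁] [InnerProductSpace ℝ E₁] [FiniteDimensional ℝ E₁]
    [NormedAddCommGroup K] [InnerProductSpace ℝ K] [FiniteDimensional ℝ K]
    {m : ℕ} (b : Module.Basis (Fin m) ℝ E)
    (T : E →ₗ[ℝ] K) (g : K) (A : E →ₗ[ℝ] E₁) (f : E₁) (hf : ∃ v, A v = f)
    (γ p r : ℝ) (hγ : 0 < γ) (hp : 1 ≤ p) (hr : 0 < r) :
    (∀ ε : ℝ, 0 ≤ ε → ε < r →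
      (constrainedMinimizers (objective b T g γ p r ε) A f).Nonempty) ∧
    ∃ M : Set E, IsCompact M ∧ ∀ ε : ℝ, 0 ≤ ε → ε < r →
      (constrainedMinimizers (objective b T g γ p r ε) A f ∩ M).Nonempty := by
  have h := exists_compact_forall_constrainedMinimizers b T g A f hf γ p r hγ hp
  refine ⟨fun ε hε hεr => ?_, h⟩
  obtain ⟨M, -, hM⟩ := h
  exact (hM ε hε hεr).mono Set.inter_subset_left
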